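/- Let $\alpha<0$ and $\omega_n=\binom{n-\alpha}{n}^{-1}$ for $n\ge 0$. Let $A^2_{-1-\alpha}$ be the Hilbert space of holomorphic functions $f(z)=\sum_{n\ge0}f_nz^n$ on the unit disc $\mathbb D$ with $\|f\|^2=\sum_{n\ge0}|f_n|^2\omega_n<\infty$, with inner product $\langle f,g\rangle=\sum_{n\ge 0}f_n\overline{g_n}\,\omega_n$. For $a\in\mathbb C\setminus\{0\}$ let $M_{a-z}$ be the bounded operator $f\mapsto (a-z)f$ on $A^2_{-1-\alpha}$, let $V_a=M_{a-z}^*M_{a-z}$, and let $\sigma_p(V_a)$ denote its point spectrum (the set of its eigenvalues). For $j\in\mathbb N=\{0,1,2,\dots\}$ put $$\varrho_j=\sqrt{\alpha^2+4|a|^2(j+1)(j+1-\alpha)}.$$ (i) If $0<|a|<1$, then $$\sigma_p(V_a)=\left\{\lambda_j:=|a|^2+1+\frac{\alpha^2-(2j+2-\alpha)\varrho_j}{2(j+1)(j+1-\alpha)} : j\in\mathbb N\right\}.$$ Moreover, for every $j\in\mathbb N$ the eigenspace $\ker(V_a-\lambda_jI)$ is one-dimensional and $$\ker(V_a-\lambda_jI)=\mathrm{span}\left\{\frac{\Big(z-\frac{\varrho_j+\alpha}{2\overline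 a(j+1)}\Big)^j}{\Big(1-\frac{\varrho_j+\alpha}{2a(j+1)}\,z\Big)^{j+2-\alpha}}\right\},$$ where the power in the denominator is the principal branch. (ii) If $|a|\ge1$, then $\sigma_p(V_a)=\emptyset$. -/

import Mathlib

open Filter Topology

noncomputable section

/-! Weighted Hardy spaces over the unit disc, and the operators
`V_a = M_{a-z}^* M_{a-z}` acting on them. -/

/-- A valid weight: a monotonic positive sequence `ω` with `ω 0 = 1`, with
`ω (n+1) / ω n → 1` and with `∑ (1 - ω (n+1) / ω n) ^ 2 < ∞`. -/
structure ValidWeight where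
  w : ℕ → ℝ
  pos : ∀ n, 0 < w n
  monotonic : Monotone w ∨ Antitone w
  w_zero : w 0 = 1
  ratio_tendsto : Tendsto (fun n => w (n + 1) / w n) atTop (𝓝 1)
  ratio_summable : Summable (fun n => (1 - w (n + 1) / w n) ^ 2)

/-- The open unit disc. -/
abbrev Disc : Type := Metric.ball (0 : ℂ) 1

/-- Extension by zero of a function on the disc to the whole plane. -/
def extendDisc (f : Disc → ℂ) : ℂ → ℂ := Function.extend Subtype.val f 0

/-- The `n`-th Maclaurin coefficient of a function on the disc. -/
def maclaurin (f : Disc → ℂ) (n : ℕ) : ℂ :=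
  iteratedDeriv n (extendDisc f) 0 / (n.factorial : ℂ)

/-- Holomorphic functions on the disc. -/
def IsHolo (f : Disc → ℂ) : Prop :=
  DifferentiableOn ℂ (extendDisc f) (Metric.ball 0 1)

theorem extendDisc_apply (f : Disc → ℂ) (z : Disc) : extendDisc f z = f z :=
  Subtype.val_injective.extend_apply f 0 z

theorem IsHolo.hasSum {f : Disc → ℂ} (hf : IsHolo f) (z : Disc) :
    HasSum (fun n => maclaurin f n * (z : ℂ) ^ n) (f z) := by
  have h := Complex.hasSum_taylorSeries_on_ball hf z.2
  rw [extendDisc_apply] at h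
  have e : (fun n : ℕ => ((n.factorial : ℂ))⁻¹ • ((z : ℂ) - 0) ^ n
      • iteratedDeriv n (extendDisc f) 0) = fun n => maclaurin f n * (z : ℂ) ^ n := by
    funext n
    simp only [maclaurin, smul_eq_mul, sub_zero]
    ring
  rwa [e] at h

/-- A function on the disc given by a convergent power series is holomorphic and the
coefficients of the series are its Maclaurin coefficients. -/
theorem holo_of_hasSum {f : Disc → ℂ} {c : ℕ → ℂ}
    (h : ∀ z : Disc, HasSum (fun n => c n * (z : ℂ) ^ n) (f z)) :
    IsHolo f ∧ maclaurin f = c := by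
  have hps : HasFPowerSeriesOnBall (extendDisc f)
      (FormalMultilinearSeries.ofScalars ℂ c) 0 1 := by
    refine ⟨?_, one_pos, ?_⟩
    · refine ENNReal.le_of_forall_nnreal_lt fun r hr => ?_
      have hr' : (r : ℝ) < 1 := by exact_mod_cast hr
      refine FormalMultilinearSeries.le_radius_of_summable _ ?_
      have hz : ((r : ℝ) : ℂ) ∈ Metric.ball (0 : ℂ) 1 := by
        simpa using hr'
      have := (h ⟨_, hz⟩).summable.norm
      simpa using this
    · intro y hy
      have hy' : y ∈ Metric.ball (0 : ℂ) 1 := by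
        rw [← ENNReal.ofReal_one, Metric.eball_ofReal] at hy
        exact hy
      have := h ⟨y, hy'⟩
      rw [← extendDisc_apply f] at this
      simpa [FormalMultilinearSeries.ofScalars_apply_eq, zero_add, smul_eq_mul, mul_comm] using this
  have hd : IsHolo f := by
    have := hps.differentiableOn
    rwa [← ENNReal.ofReal_one, Metric.eball_ofReal] at this
  refine ⟨hd, ?_⟩
  funext n
  have h1 := hps.hasFPowerSeriesAt
  have h2 := h1.analyticAt.hasFPowerSeriesAt
  have h3 := h1.eq_formalMultilinearSeries h2
  rw [FormalMultilinearSeries.ofScalars_series_eq_iff] at h3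
  rw [h3]
  rfl

/-- The weighted Hardy space `H²_ω` as a subspace of the functions on the disc. -/
def hardySubmodule (ω : ValidWeight) : Submodule ℂ (Disc → ℂ) where
  carrier := {f | IsHolo f ∧ Summable fun n => ‖maclaurin f n‖ ^ 2 * ω.w n}
  zero_mem' := by
    have h := holo_of_hasSum (f := 0) (c := 0) (fun z => by simp)
    refine ⟨h.1, ?_⟩
    rw [h.2]
    simp
  add_mem' := by
    intro f g hf hg
    have h := holo_of_hasSum (f := f + g) (c := maclaurin f + maclaurin g) (fun z => by
      simpa [add_mul] using (hf.1.hasSum z).add (hg.1.hasSum z))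
    refine ⟨h.1, ?_⟩
    rw [h.2]
    refine Summable.of_nonneg_of_le (fun n => mul_nonneg (by positivity) (ω.pos n).le)
      (fun n => ?_) ((hf.2.mul_left 2).add (hg.2.mul_left 2))
    have h1 := norm_add_le (maclaurin f n) (maclaurin g n)
    have h2 : ‖maclaurin f n + maclaurin g n‖ ^ 2
        ≤ 2 * ‖maclaurin f n‖ ^ 2 + 2 * ‖maclaurin g n‖ ^ 2 := by
      nlinarith [norm_nonneg (maclaurin f n + maclaurin g n),
        sq_nonneg (‖maclaurin f n‖ - ‖maclaurin g n‖)]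
    have := mul_le_mul_of_nonneg_right h2 (ω.pos n).le
    simp only [Pi.add_apply]
    linarith
  smul_mem' := by
    intro k f hf
    have h := holo_of_hasSum (f := k • f) (c := k • maclaurin f) (fun z => by
      simpa [mul_assoc] using (hf.1.hasSum z).mul_left k)
    refine ⟨h.1, ?_⟩
    rw [h.2]
    simpa [mul_pow, mul_assoc] using hf.2.mul_left (‖k‖ ^ 2)

/-- The weighted Hardy space `H²_ω`: holomorphic functions on the disc whose Maclaurin
coefficients `c n` satisfy `∑ |c n|² ω n < ∞`. -/
def HardySpace (ω : ValidWeight) : Type := hardySubmodule ω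

namespace HardySpace

variable {ω : ValidWeight}

instance : AddCommGroup (HardySpace ω) := inferInstanceAs (AddCommGroup (hardySubmodule ω))

instance : Module ℂ (HardySpace ω) := inferInstanceAs (Module ℂ (hardySubmodule ω))

instance : CoeFun (HardySpace ω) (fun _ => Disc → ℂ) := ⟨fun f => f.1⟩

theorem ext_fun {f g : HardySpace ω} (h : ∀ z, f z = g z) : f = g :=
  Subtype.ext (funext h)

/-- The `n`-th Maclaurin coefficient. -/
def coeff (f : HardySpace ω) (n : ℕ) : ℂ := maclaurin f.1 n

theorem hasSum (f : HardySpace ω) (z : Disc) :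
    HasSum (fun n => f.coeff n * (z : ℂ) ^ n) (f z) := f.2.1.hasSum z

theorem coeff_eq {f : HardySpace ω} {c : ℕ → ℂ}
    (h : ∀ z : Disc, HasSum (fun n => c n * (z : ℂ) ^ n) (f z)) : f.coeff = c :=
  (holo_of_hasSum h).2

theorem coeff_add (f g : HardySpace ω) : (f + g).coeff = f.coeff + g.coeff :=
  coeff_eq fun z => by
    have h : HasSum _ ((f + g) z) := (f.hasSum z).add (g.hasSum z)
    simpa [add_mul] using h

theorem coeff_smul (k : ℂ) (f : HardySpace ω) : (k • f).coeff = k • f.coeff :=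
  coeff_eq fun z => by
    have h : HasSum _ ((k • f) z) := (f.hasSum z).mul_left k
    simpa [mul_assoc] using h

theorem norm_sqrt_mul_sq (c : ℂ) (n : ℕ) :
    ‖((√(ω.w n) : ℝ) : ℂ) * c‖ ^ 2 = ‖c‖ ^ 2 * ω.w n := by
  rw [norm_mul, mul_pow, Complex.norm_real, Real.norm_eq_abs, sq_abs,
    Real.sq_sqrt (ω.pos n).le, mul_comm]

theorem sqrt_ne (n : ℕ) : ((√(ω.w n) : ℝ) : ℂ) ≠ 0 :=
  Complex.ofReal_ne_zero.mpr (Real.sqrt_ne_zero'.mpr (ω.pos n))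

/-- Coordinates of an element of `H²_ω` in the orthonormal basis `z ^ n / √(ω n)`. -/
def toEll (f : HardySpace ω) : lp (fun _ : ℕ => ℂ) 2 :=
  ⟨fun n => ((√(ω.w n) : ℝ) : ℂ) * f.coeff n, by
    refine memℓp_gen ?_
    simp only [ENNReal.toReal_ofNat, Real.rpow_ofNat, norm_sqrt_mul_sq]
    exact f.2.2⟩

theorem toEll_apply (f : HardySpace ω) (n : ℕ) :
    (toEll f : ℕ → ℂ) n = ((√(ω.w n) : ℝ) : ℂ) * f.coeff n := rfl

/-- The inner product `∑ aₙ conj(bₙ) ωₙ`, written with Mathlib's convention (conjugate-linear in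
the first variable). -/
def ip (f g : HardySpace ω) : ℂ :=
  ∑' n, starRingEnd ℂ (f.coeff n) * g.coeff n * (ω.w n : ℂ)

theorem inner_toEll (f g : HardySpace ω) : inner ℂ (toEll f) (toEll g) = ip f g := by
  rw [lp.inner_eq_tsum, ip]
  refine tsum_congr fun n => ?_
  simp only [toEll_apply, RCLike.inner_apply, map_mul, Complex.conj_ofReal]
  have : ((√(ω.w n) : ℝ) : ℂ) * ((√(ω.w n) : ℝ) : ℂ) = (ω.w n : ℂ) := by
    rw [← Complex.ofReal_mul, Real.mul_self_sqrt (ω.pos n).le]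
  rw [← this]
  ring

theorem toEll_add (f g : HardySpace ω) : toEll (f + g) = toEll f + toEll g := by
  ext n
  simp [toEll_apply, coeff_add, mul_add]

theorem toEll_smul (k : ℂ) (f : HardySpace ω) : toEll (k • f) = k • toEll f := by
  ext n
  simp [toEll_apply, coeff_smul]
  ring

theorem eq_of_toEll_eq {f g : HardySpace ω} (h : toEll f = toEll g) : f = g := by
  have hc : f.coeff = g.coeff := by
    funext n
    have := congrArg (fun x : lp (fun _ : ℕ => ℂ) 2 => (x : ℕ → ℂ) n) h
    exact mul_left_cancel₀ (sqrt_ne n) this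
  refine ext_fun fun z => ?_
  have h1 := f.hasSum z
  rw [hc] at h1
  exact h1.unique (g.hasSum z)

theorem toEll_zero : toEll (0 : HardySpace ω) = 0 := by
  have := toEll_smul (0 : ℂ) (0 : HardySpace ω)
  simpa using this

/-- The inner product space structure of `H²_ω`. -/
@[reducible] def core : InnerProductSpace.Core ℂ (HardySpace ω) where
  inner := ip
  conj_inner_symm f g := by
    rw [← inner_toEll, ← inner_toEll]
    exact inner_conj_symm _ _
  re_inner_nonneg f := by
    rw [← inner_toEll]
    exact inner_self_nonneg
  add_left f g k := by
    simp only [← inner_toEll, toEll_add, inner_add_left]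
  smul_left f g k := by
    simp only [← inner_toEll, toEll_smul, inner_smul_left]
  definite f hf := by
    rw [← inner_toEll, inner_self_eq_zero] at hf
    exact eq_of_toEll_eq (hf.trans toEll_zero.symm)

instance : NormedAddCommGroup (HardySpace ω) :=
  @InnerProductSpace.Core.toNormedAddCommGroup ℂ _ _ _ _ core

instance : InnerProductSpace ℂ (HardySpace ω) := InnerProductSpace.ofCore core.toCore

theorem inner_def (f g : HardySpace ω) :
    inner ℂ f g = ∑' n, starRingEnd ℂ (f.coeff n) * g.coeff n * (ω.w n : ℂ) := rfl

theorem norm_toEll (f : HardySpace ω) : ‖toEll f‖ = ‖f‖ := by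
  rw [@norm_eq_sqrt_re_inner ℂ, @norm_eq_sqrt_re_inner ℂ _ _ _ _ f, inner_toEll]
  rfl

theorem hasSum_norm_sq (f : HardySpace ω) :
    HasSum (fun n => ‖f.coeff n‖ ^ 2 * ω.w n) (‖f‖ ^ 2) := by
  have h := lp.hasSum_norm (p := 2) (by norm_num) (toEll f)
  simp only [norm_toEll, ENNReal.toReal_ofNat, Real.rpow_ofNat, toEll_apply,
    norm_sqrt_mul_sq] at h
  exact h

/-- Square-summable coefficients define an element of the space. -/
theorem exists_of_summable (c : ℕ → ℂ) (hc : Summable fun n => ‖c n‖ ^ 2 * ω.w n) :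
    ∃ f : HardySpace ω, f.coeff = c := by
  have key : ∀ z : Disc, Summable fun n => c n * (z : ℂ) ^ n := by
    intro z
    have hz : ‖(z : ℂ)‖ < 1 := mem_ball_zero_iff.mp z.2
    have hs : Summable fun n => ‖(z : ℂ)‖ ^ (2 * n) / ω.w n := by
      by_cases h0 : ‖(z : ℂ)‖ = 0
      · refine summable_of_ne_finset_zero (s := {0}) fun n hn => ?_
        have : 2 * n ≠ 0 := by simpa using hn
        simp [h0, this]
      · have hpos : 0 < ‖(z : ℂ)‖ := lt_of_le_of_ne (norm_nonneg _) (Ne.symm h0)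
        refine summable_of_ratio_test_tendsto_lt_one (l := ‖(z : ℂ)‖ ^ 2) (by nlinarith)
          (Eventually.of_forall fun n => (div_pos (by positivity) (ω.pos n)).ne') ?_
        have := (ω.ratio_tendsto.inv₀ one_ne_zero).const_mul (‖(z : ℂ)‖ ^ 2)
        rw [inv_one, mul_one] at this
        refine this.congr fun n => ?_
        have h1 := ω.pos n
        have h2 := ω.pos (n + 1)
        rw [Real.norm_of_nonneg (by positivity), Real.norm_of_nonneg (by positivity)]
        field_simp
        ring
    refine Summable.of_norm_bounded (hc.add hs) fun n => ?_
    have h1 := ω.pos n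
    have h2 : ‖c n * (z : ℂ) ^ n‖ = (‖c n‖ * √(ω.w n)) * (‖(z : ℂ)‖ ^ n / √(ω.w n)) := by
      have : √(ω.w n) ≠ 0 := (Real.sqrt_pos.mpr h1).ne'
      rw [norm_mul, norm_pow]
      field_simp
    have h3 : (‖c n‖ * √(ω.w n)) ^ 2 = ‖c n‖ ^ 2 * ω.w n := by
      rw [mul_pow, Real.sq_sqrt h1.le]
    have h4 : (‖(z : ℂ)‖ ^ n / √(ω.w n)) ^ 2 = ‖(z : ℂ)‖ ^ (2 * n) / ω.w n := by
      rw [div_pow, Real.sq_sqrt h1.le, ← pow_mul, mul_comm n 2]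
    rw [h2, ← h3, ← h4]
    nlinarith [sq_nonneg (‖c n‖ * √(ω.w n)), sq_nonneg (‖(z : ℂ)‖ ^ n / √(ω.w n)),
      sq_nonneg (‖c n‖ * √(ω.w n) - ‖(z : ℂ)‖ ^ n / √(ω.w n))]
  have h := holo_of_hasSum (f := fun z => ∑' n, c n * (z : ℂ) ^ n) (c := c)
    fun z => (key z).hasSum
  exact ⟨⟨_, h.1, by rw [h.2]; exact hc⟩, h.2⟩

theorem toEll_surjective : Function.Surjective (toEll (ω := ω)) := by
  intro x
  obtain ⟨f, hf⟩ := exists_of_summable (ω := ω)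
    (fun n => (((√(ω.w n) : ℝ) : ℂ))⁻¹ * (x : ℕ → ℂ) n) (by
      have h := (lp.hasSum_norm (p := 2) (by norm_num) x).summable
      convert h using 2 with n
      rw [← norm_sqrt_mul_sq, mul_inv_cancel_left₀ (sqrt_ne n)]
      norm_num)
  refine ⟨f, ?_⟩
  ext n
  rw [toEll_apply, hf, mul_inv_cancel_left₀ (sqrt_ne n)]

/-- `H²_ω` is unitarily equivalent to `ℓ²`. -/
def ellEquiv : HardySpace ω ≃ₗᵢ[ℂ] lp (fun _ : ℕ => ℂ) 2 :=
  LinearIsometryEquiv.ofSurjective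
    { toFun := toEll
      map_add' := toEll_add
      map_smul' := toEll_smul
      norm_map' := norm_toEll } toEll_surjective

instance : CompleteSpace (HardySpace ω) :=
  (ellEquiv (ω := ω)).toIsometryEquiv.completeSpace

theorem exists_ratio_bound (ω : ValidWeight) : ∃ C : ℝ, 0 ≤ C ∧ ∀ n, ω.w (n + 1) ≤ C * ω.w n := by
  obtain ⟨C, hC⟩ := ω.ratio_tendsto.bddAbove_range
  have hC' : ∀ n, ω.w (n + 1) / ω.w n ≤ C := fun n => hC ⟨n, rfl⟩
  exact ⟨C, (div_pos (ω.pos 1) (ω.pos 0)).le.trans (hC' 0),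
    fun n => (div_le_iff₀ (ω.pos n)).mp (hC' n)⟩

/-- Multiplication by `z` maps the space to itself, and shifts the coefficients. -/
theorem exists_shift (f : HardySpace ω) : ∃ g : HardySpace ω,
    (∀ z : Disc, g z = (z : ℂ) * f z) ∧ g.coeff 0 = 0 ∧ ∀ n, g.coeff (n + 1) = f.coeff n := by
  obtain ⟨C, -, hC⟩ := exists_ratio_bound ω
  obtain ⟨g, hg⟩ := exists_of_summable (ω := ω)
    (fun n => Nat.casesOn n 0 fun k => f.coeff k) (by
      rw [← summable_nat_add_iff 1]
      refine Summable.of_nonneg_of_le (fun n => mul_nonneg (by positivity) (ω.pos _).le)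
        (fun n => ?_) (f.2.2.mul_left C)
      have := mul_le_mul_of_nonneg_left (hC n) (sq_nonneg ‖f.coeff n‖)
      simp only [coeff] at this ⊢
      linarith)
  refine ⟨g, fun z => ?_, congrFun hg 0, fun n => congrFun hg (n + 1)⟩
  have h1 := g.hasSum z
  rw [← hasSum_nat_add_iff' 1, hg] at h1
  have h2 := (f.hasSum z).mul_left (z : ℂ)
  have e : (fun n => (z : ℂ) * (f.coeff n * (z : ℂ) ^ n))
      = fun n => f.coeff n * (z : ℂ) ^ (n + 1) := by
    funext n
    ring
  rw [e] at h2
  have h3 := h1.unique h2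
  simpa using h3

/-- `a - z` is a multiplier: it maps `H²_ω` to itself by pointwise multiplication. -/
theorem sub_mul_mem (a : ℂ) (f : HardySpace ω) :
    (fun z : Disc => (a - (z : ℂ)) * f z) ∈ hardySubmodule ω := by
  obtain ⟨g, hg, -⟩ := exists_shift f
  have : (fun z : Disc => (a - (z : ℂ)) * f z) = (a • f - g : HardySpace ω).1 := by
    funext z
    change _ = a * f z - g z
    rw [hg z]
    ring
  rw [this]
  exact (a • f - g : HardySpace ω).2

/-- Pointwise multiplication by `a - z` as a linear map. -/
def mulSubLinear (ω : ValidWeight) (a : ℂ) : HardySpace ω →ₗ[ℂ] HardySpace ω where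
  toFun f := ⟨fun z : Disc => (a - (z : ℂ)) * f z, sub_mul_mem a f⟩
  map_add' _ _ := ext_fun fun _ => mul_add _ _ _
  map_smul' _ _ := ext_fun fun _ => mul_left_comm _ _ _

theorem exists_bound_mulSub (ω : ValidWeight) (a : ℂ) :
    ∃ C : ℝ, ∀ f : HardySpace ω, ‖mulSubLinear ω a f‖ ≤ C * ‖f‖ := by
  obtain ⟨C, hC0, hC⟩ := exists_ratio_bound ω
  refine ⟨‖a‖ + √C, fun f => ?_⟩
  obtain ⟨g, hg, hg0, hg1⟩ := exists_shift f
  have h1 : mulSubLinear ω a f = a • f - g := ext_fun fun z => by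
    change (a - (z : ℂ)) * f z = a * f z - g z
    rw [hg z]
    ring
  have h2 : ‖g‖ ^ 2 ≤ C * ‖f‖ ^ 2 := by
    have hs := g.hasSum_norm_sq
    rw [← hasSum_nat_add_iff' 1] at hs
    have hs' := hasSum_le (fun n => ?_) hs (f.hasSum_norm_sq.mul_left C)
    · simpa [hg0] using hs'
    · rw [hg1]
      have := mul_le_mul_of_nonneg_left (hC n) (sq_nonneg ‖f.coeff n‖)
      linarith
  have h3 : ‖g‖ ≤ √C * ‖f‖ := by
    refine abs_le_of_sq_le_sq' ?_ (by positivity) |>.2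
    rw [mul_pow, Real.sq_sqrt hC0]
    exact h2
  rw [h1]
  calc ‖a • f - g‖ ≤ ‖a • f‖ + ‖g‖ := norm_sub_le _ _
    _ ≤ ‖a‖ * ‖f‖ + √C * ‖f‖ := by rw [norm_smul]; gcongr
    _ = (‖a‖ + √C) * ‖f‖ := by ring

/-- The bounded multiplication operator `M_{a-z}` on `H²_ω`. -/
def mulSub (ω : ValidWeight) (a : ℂ) : HardySpace ω →L[ℂ] HardySpace ω :=
  (mulSubLinear ω a).mkContinuousOfExistsBound (exists_bound_mulSub ω a)

theorem mulSub_apply (ω : ValidWeight) (a : ℂ) (f : HardySpace ω) (z : Disc) :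
    mulSub ω a f z = (a - (z : ℂ)) * f z := rfl

/-- The operator `V_a = M_{a-z}^* M_{a-z}` on `H²_ω`. -/
def V (ω : ValidWeight) (a : ℂ) : HardySpace ω →L[ℂ] HardySpace ω :=
  (ContinuousLinearMap.adjoint (mulSub ω a)).comp (mulSub ω a)

end HardySpace

/-- The point spectrum (set of eigenvalues) of a bounded operator. -/
def pointSpectrum {H : Type*} [NormedAddCommGroup H] [NormedSpace ℂ H] (T : H →L[ℂ] H) : Set ℂ :=
  {μ | ∃ h : H, h ≠ 0 ∧ T h = μ • h}

/-- The weight `ω n = binom(n - α, n)⁻¹`. -/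
def bergmanW (α : ℝ) (n : ℕ) : ℝ := (Ring.choose ((n : ℝ) - α) n)⁻¹

theorem choose_succ_shift (α : ℝ) (n : ℕ) :
    Ring.choose (((n + 1 : ℕ) : ℝ) - α) (n + 1)
      = ((n : ℝ) + 1 - α) / ((n : ℝ) + 1) * Ring.choose ((n : ℝ) - α) n := by
  have hn : (n : ℝ) + 1 ≠ 0 := by positivity
  have hf : (n.factorial : ℝ) ≠ 0 := by positivity
  rw [Ring.choose_eq_smul, Ring.choose_eq_smul, descPochhammer_succ_left,
    Polynomial.smeval_mul, Polynomial.smeval_comp, Polynomial.smeval_X, Polynomial.smeval_sub,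
    Polynomial.smeval_X, Polynomial.smeval_one]
  have : ((n + 1 : ℕ) : ℝ) - α - 1 = (n : ℝ) - α := by push_cast; ring
  simp only [pow_one, pow_zero, one_smul, this, Nat.factorial_succ, smul_eq_mul]
  push_cast
  field_simp

theorem bergmanW_succ (α : ℝ) (n : ℕ) :
    bergmanW α (n + 1) = ((n : ℝ) + 1) / ((n : ℝ) + 1 - α) * bergmanW α n := by
  rw [bergmanW, choose_succ_shift, mul_inv, inv_div, bergmanW]

theorem bergmanW_pos {α : ℝ} (hα : α < 0) (n : ℕ) : 0 < bergmanW α n := by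
  induction n with
  | zero => simp [bergmanW]
  | succ n ih =>
    rw [bergmanW_succ]
    have : 0 < (n : ℝ) + 1 - α := by linarith [(n.cast_nonneg : (0 : ℝ) ≤ n)]
    positivity

theorem bergmanW_ratio {α : ℝ} (hα : α < 0) (n : ℕ) :
    bergmanW α (n + 1) / bergmanW α n = 1 + α / ((n : ℝ) + 1 - α) := by
  have : 0 < (n : ℝ) + 1 - α := by linarith [(n.cast_nonneg : (0 : ℝ) ≤ n)]
  rw [bergmanW_succ, mul_div_cancel_right₀ _ (bergmanW_pos hα n).ne']
  field_simp
  ring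

/-- The weight of the Bergman-type space `A²_{-1-α}`, `α < 0`. -/
def bergmanWeight (α : ℝ) (hα : α < 0) : ValidWeight where
  w := bergmanW α
  pos := bergmanW_pos hα
  monotonic := Or.inr (antitone_nat_of_succ_le fun n => by
    have h0 : 0 < (n : ℝ) + 1 - α := by linarith [(n.cast_nonneg : (0 : ℝ) ≤ n)]
    rw [← div_le_one (bergmanW_pos hα n), bergmanW_ratio hα]
    have := div_neg_of_neg_of_pos hα h0
    linarith)
  w_zero := by simp [bergmanW]
  ratio_tendsto := by
    simp only [bergmanW_ratio hα]
    have h : Tendsto (fun n : ℕ => (n : ℝ) + 1 - α) atTop atTop := by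
      simp only [add_sub_assoc]
      exact tendsto_atTop_add_const_right _ _ tendsto_natCast_atTop_atTop
    simpa using (h.const_div_atTop α).const_add 1
  ratio_summable := by
    simp only [bergmanW_ratio hα]
    have h := (summable_nat_add_iff 1).mpr (Real.summable_one_div_nat_pow.mpr one_lt_two)
    refine Summable.of_nonneg_of_le (fun n => sq_nonneg _) (fun n => ?_) (h.mul_left (α ^ 2))
    have h1 : (0 : ℝ) < (n : ℝ) + 1 := by positivity
    have h2 : (n : ℝ) + 1 ≤ (n : ℝ) + 1 - α := by linarith
    have h3 : (1 - (1 + α / ((n : ℝ) + 1 - α))) ^ 2 = α ^ 2 * (1 / ((n : ℝ) + 1 - α) ^ 2) := by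
      rw [sub_add_cancel_left, neg_sq, div_pow, mul_one_div]
    rw [h3]
    push_cast
    gcongr

/-- The Bergman-type space `A²_{-1-α}`. -/
abbrev BergmanSpace (α : ℝ) (hα : α < 0) : Type := HardySpace (bergmanWeight α hα)

/-- `ρ_j = √(α² + 4 |a|² (j+1) (j+1-α))`. -/
def rho (α : ℝ) (a : ℂ) (j : ℕ) : ℝ :=
  √(α ^ 2 + 4 * ‖a‖ ^ 2 * ((j : ℝ) + 1) * ((j : ℝ) + 1 - α))

/-- `λ_j = |a|² + 1 + (α² - (2j+2-α) ρ_j) / (2 (j+1) (j+1-α))`. -/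
def lam (α : ℝ) (a : ℂ) (j : ℕ) : ℝ :=
  ‖a‖ ^ 2 + 1 + (α ^ 2 - (2 * (j : ℝ) + 2 - α) * rho α a j)
    / (2 * ((j : ℝ) + 1) * ((j : ℝ) + 1 - α))

end

/-! ### Coefficients and symmetry of `V` -/

namespace HardySpace

variable {ω : ValidWeight}

/-! Since `V` is symmetric, an eigenvalue can be written |a|² + 1 - s with s real. Comparing
coefficients turns the eigenvalue equation into a three-term recurrence (`V_eigen_iff_recResidual`),
which is the ODE q f' = L f with q = ā z² - s z + a and L = s - α(s-1) - (2-α) ā z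
(`recResidual_iff_deriv`). As a ≠ 0, a solution is fixed by f(0), so eigenspaces have dimension at
most one.

If s² ≤ 4|a|², the zeros of q lie on the circle, and -i q generates a flow of disc automorphisms
carrying 0 to the boundary. Along the orbit |f|²(1-|z|²)^(2-α) is constant, while membership in the
space bounds |f|²(1-|z|²)^(1-α); hence f(0) = 0 (`apply_zero_eq_zero_of_sq_le`).

If s² > 4|a|², q has a simple zero p/ā in the disc. The vanishing order j of f there must satisfy
q'(p/ā) j = L(p/ā), a quadratic relation for p which forces |a| < 1 and gives s in terms of j
(`holo_eigen_exists_nat`, `lam_of_root`). Conversely, when |a| < 1 each j yields such a p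
(`exists_root`), and the explicit solution of the ODE is holomorphic past the closed disc, hence an
eigenvector (`exists_eigenvector`). -/

theorem eq_of_coeff_eq {f g : HardySpace ω} (h : f.coeff = g.coeff) : f = g :=
  ext_fun fun z => by
    have h1 := f.hasSum z
    rw [h] at h1
    exact h1.unique (g.hasSum z)

theorem exists_monomial (n : ℕ) : ∃ e : HardySpace ω, e.coeff = Pi.single n 1 :=
  exists_of_summable _ (summable_of_ne_finset_zero (s := {n}) fun m hm => by
    have : m ≠ n := by simpa using hm
    simp [this])

theorem inner_of_coeff_single {e : HardySpace ω} {n : ℕ} (he : e.coeff = Pi.single n 1)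
    (f : HardySpace ω) : inner ℂ e f = f.coeff n * (ω.w n : ℂ) := by
  rw [inner_def, he, tsum_eq_single n]
  · simp
  · intro m hm
    simp [hm]

theorem mulSub_coeff_zero (a : ℂ) (f : HardySpace ω) :
    (mulSub ω a f).coeff 0 = a * f.coeff 0 := by
  obtain ⟨g, hg, hg0, -⟩ := exists_shift f
  have h : mulSub ω a f + g = a • f := ext_fun fun z => by
    change (a - (z : ℂ)) * f z + g z = a * f z
    rw [hg z]
    ring
  have h2 := congrFun (congrArg coeff h) 0
  rw [coeff_add, coeff_smul] at h2
  simpa [hg0] using h2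

theorem mulSub_coeff_succ (a : ℂ) (f : HardySpace ω) (n : ℕ) :
    (mulSub ω a f).coeff (n + 1) = a * f.coeff (n + 1) - f.coeff n := by
  obtain ⟨g, hg, -, hg1⟩ := exists_shift f
  have h : mulSub ω a f + g = a • f := ext_fun fun z => by
    change (a - (z : ℂ)) * f z + g z = a * f z
    rw [hg z]
    ring
  have h2 := congrFun (congrArg coeff h) (n + 1)
  rw [coeff_add, coeff_smul] at h2
  simp only [Pi.add_apply, Pi.smul_apply, smul_eq_mul, hg1] at h2
  linear_combination h2

/-- Pair V f with zⁿ and move the adjoint across: ⟨zⁿ, V f⟩ = ⟨(a - z) zⁿ, (a - z) f⟩, and (a - z)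
zⁿ involves only two monomials. -/
theorem V_coeff (a : ℂ) (f : HardySpace ω) (n : ℕ) :
    (V ω a f).coeff n * (ω.w n : ℂ)
      = starRingEnd ℂ a * (mulSub ω a f).coeff n * (ω.w n : ℂ)
        - (mulSub ω a f).coeff (n + 1) * (ω.w (n + 1) : ℂ) := by
  obtain ⟨e, he⟩ := exists_monomial (ω := ω) n
  obtain ⟨e', he'⟩ := exists_monomial (ω := ω) (n + 1)
  have hM : mulSub ω a e = a • e - e' := by
    rw [eq_sub_iff_add_eq]
    refine eq_of_coeff_eq (funext fun m => ?_)
    rw [coeff_add, coeff_smul, he']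
    rcases m with _ | m
    · simp [mulSub_coeff_zero]
    · simp only [Pi.add_apply, mulSub_coeff_succ, he, Pi.smul_apply, smul_eq_mul, Pi.single_apply,
        Nat.add_right_cancel_iff]
      ring
  rw [← inner_of_coeff_single he, V, ContinuousLinearMap.comp_apply,
    ContinuousLinearMap.adjoint_inner_right, hM, inner_sub_left, inner_smul_left,
    inner_of_coeff_single he, inner_of_coeff_single he']
  ring

/-- Predecessor coefficient, with `f₋₁ = 0`. -/
def prevCoeff (c : ℕ → ℂ) : ℕ → ℂ
  | 0 => 0
  | n + 1 => c n

theorem mulSub_coeff (a : ℂ) (f : HardySpace ω) (n : ℕ) :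
    (mulSub ω a f).coeff n = a * f.coeff n - prevCoeff f.coeff n := by
  rcases n with _ | n
  · simp [mulSub_coeff_zero, prevCoeff]
  · simp [mulSub_coeff_succ, prevCoeff]

theorem V_isSymmetric (a : ℂ) : (V ω a).toLinearMap.IsSymmetric := by
  intro f g
  simp only [ContinuousLinearMap.coe_coe, V, ContinuousLinearMap.comp_apply,
    ContinuousLinearMap.adjoint_inner_right, ContinuousLinearMap.adjoint_inner_left]

/-- Reality of the eigenvalue makes the spectral parameter s real, on which the split by the sign of
s² - 4|a|² depends. -/
theorem exists_real_of_eigen {a μ : ℂ} {f : HardySpace ω} (hf : f ≠ 0) (h : V ω a f = μ • f) :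
    ∃ r : ℝ, μ = (r : ℂ) := by
  have h1 := (V_isSymmetric (ω := ω) a).conj_eigenvalue_eq_self (μ := μ)
    (Module.End.hasEigenvalue_of_hasEigenvector ⟨Module.End.mem_eigenspace_iff.mpr h, hf⟩)
  exact ⟨μ.re, (Complex.conj_eq_iff_re.mp h1).symm⟩

end HardySpace

/-! ### The eigenvalue equation as a recurrence -/

/-- The residual of the three-term recurrence for the coefficients of an eigenvector of `V_a`
with eigenvalue `|a|² + 1 - s`. -/
noncomputable def recResidual (α : ℝ) (a : ℂ) (s : ℝ) (c : ℕ → ℂ) (n : ℕ) : ℂ :=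
  (s * (n + 1) - α * (s - 1)) * c n - starRingEnd ℂ a * (n + 1 - α) * HardySpace.prevCoeff c n
    - a * (n + 1) * c (n + 1)

/-- By `V_coeff` and ω(n+1)/ω(n) = (n+1)/(n+1-α), the residual is n+1-α times the n-th coefficient
of V f - μ f, and this factor is nonzero because α < 0. -/
theorem V_eigen_iff_recResidual {α : ℝ} (hα : α < 0) (a : ℂ) (s : ℝ) (f : BergmanSpace α hα) :
    HardySpace.V (bergmanWeight α hα) a f = ((‖a‖ ^ 2 + 1 - s : ℝ) : ℂ) • f
      ↔ ∀ n, recResidual α a s f.coeff n = 0 := by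
  have key : ∀ n : ℕ, ((HardySpace.V (bergmanWeight α hα) a f).coeff n
      - ((‖a‖ ^ 2 + 1 - s : ℝ) : ℂ) * f.coeff n) * ((n : ℂ) + 1 - α)
      = recResidual α a s f.coeff n := by
    intro n
    have hV := HardySpace.V_coeff (ω := bergmanWeight α hα) a f n
    have hw : ((bergmanWeight α hα).w n : ℂ) ≠ 0 :=
      Complex.ofReal_ne_zero.mpr (bergmanW_pos hα n).ne'
    have h0 : (n : ℝ) + 1 - α ≠ 0 := by
      have : (0 : ℝ) ≤ n := n.cast_nonneg
      linarith
    have hc : (n : ℂ) + 1 - α ≠ 0 := by exact_mod_cast Complex.ofReal_ne_zero.mpr h0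
    have hs : ((bergmanWeight α hα).w (n + 1) : ℂ)
        = ((n : ℂ) + 1) / ((n : ℂ) + 1 - α) * ((bergmanWeight α hα).w n : ℂ) := by
      change ((bergmanW α (n + 1) : ℝ) : ℂ) = _ * ((bergmanW α n : ℝ) : ℂ)
      rw [bergmanW_succ]
      push_cast
      rfl
    have ha : ((‖a‖ : ℝ) : ℂ) ^ 2 = starRingEnd ℂ a * a := (Complex.conj_mul' a).symm
    rw [HardySpace.mulSub_coeff, HardySpace.mulSub_coeff, hs] at hV
    have hp : HardySpace.prevCoeff f.coeff (n + 1) = f.coeff n := rfl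
    rw [hp] at hV
    have hV' : (HardySpace.V (bergmanWeight α hα) a f).coeff n
        = starRingEnd ℂ a * (a * f.coeff n - HardySpace.prevCoeff f.coeff n)
          - (a * f.coeff (n + 1) - f.coeff n) * (((n : ℂ) + 1) / ((n : ℂ) + 1 - α)) := by
      apply mul_right_cancel₀ hw
      rw [hV]
      ring
    rw [hV', recResidual]
    push_cast
    rw [ha]
    field_simp
    ring
  constructor
  · intro h n
    rw [← key, h, HardySpace.coeff_smul]
    simp
  · intro h
    refine HardySpace.eq_of_coeff_eq (funext fun n => ?_)
    have h0 : (n : ℝ) + 1 - α ≠ 0 := by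
      have : (0 : ℝ) ≤ n := n.cast_nonneg
      linarith
    have hc : (n : ℂ) + 1 - α ≠ 0 := by exact_mod_cast Complex.ofReal_ne_zero.mpr h0
    have := (key n).trans (h n)
    rw [HardySpace.coeff_smul]
    exact sub_eq_zero.mp ((mul_eq_zero.mp this).resolve_right hc)

/-- A solution of the recurrence is determined by its first term. -/
theorem recResidual_unique {α : ℝ} {a : ℂ} {s : ℝ} (ha : a ≠ 0) {c d : ℕ → ℂ}
    (hc : ∀ n, recResidual α a s c n = 0) (hd : ∀ n, recResidual α a s d n = 0) (n : ℕ) :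
    d 0 * c n = c 0 * d n := by
  have step : ∀ n : ℕ, d 0 * HardySpace.prevCoeff c n = c 0 * HardySpace.prevCoeff d n →
      d 0 * c n = c 0 * d n → d 0 * c (n + 1) = c 0 * d (n + 1) := by
    intro n h1 h2
    have h3 : a * ((n : ℂ) + 1) ≠ 0 := mul_ne_zero ha (Nat.cast_add_one_ne_zero n)
    have e1 := hc n
    have e2 := hd n
    rw [recResidual] at e1 e2
    apply mul_left_cancel₀ h3
    linear_combination c 0 * e2 - d 0 * e1 + (s * (n + 1) - α * (s - 1) : ℂ) * h2
      - starRingEnd ℂ a * (n + 1 - α) * h1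
  -- The recurrence has order two, so two consecutive terms are carried; the convention c₋₁ = 0
  -- supplies the second initial condition.
  have both : ∀ n : ℕ, d 0 * HardySpace.prevCoeff c n = c 0 * HardySpace.prevCoeff d n ∧
      d 0 * c n = c 0 * d n := by
    intro n
    induction n with
    | zero => exact ⟨by simp [HardySpace.prevCoeff], mul_comm _ _⟩
    | succ n ih => exact ⟨ih.2, step n ih.1 ih.2⟩
  exact (both n).2

/-! ### The recurrence as a first-order ODE -/

theorem HasSum.of_eq {ι E : Type*} [AddCommMonoid E] [TopologicalSpace E] {f g : ι → E} {x y : E}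
    (h : HasSum f x) (hf : ∀ n, g n = f n) (hx : y = x) : HasSum g y := by
  rw [funext hf, hx]
  exact h

/-- `L f - q f'` has the residuals of the recurrence as its Maclaurin coefficients. -/
theorem hasSum_recResidual (α : ℝ) (a : ℂ) (s : ℝ) {f : Disc → ℂ} (hf : IsHolo f) (z : Disc) :
    HasSum (fun n => recResidual α a s (maclaurin f) n * (z : ℂ) ^ n)
      ((s - α * (s - 1) - (2 - α) * starRingEnd ℂ a * z) * f z
        - (starRingEnd ℂ a * (z : ℂ) ^ 2 - s * z + a) * deriv (extendDisc f) z) := by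
  have h0 := hf.hasSum z
  have hd : HasSum (fun n : ℕ => ((n : ℂ) + 1) * maclaurin f (n + 1) * (z : ℂ) ^ n)
      (deriv (extendDisc f) z) := by
    have h := Complex.hasSum_taylorSeries_on_ball (hf.deriv Metric.isOpen_ball) z.2
    refine h.of_eq (fun n => ?_) rfl
    rw [maclaurin, iteratedDeriv_succ', Nat.factorial_succ]
    have : (n.factorial : ℂ) ≠ 0 := by exact_mod_cast n.factorial_ne_zero
    have : (n : ℂ) + 1 ≠ 0 := Nat.cast_add_one_ne_zero n
    simp only [smul_eq_mul, sub_zero]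
    push_cast
    field_simp
  have hzd : HasSum (fun n : ℕ => (n : ℂ) * maclaurin f n * (z : ℂ) ^ n)
      (z * deriv (extendDisc f) z) := by
    rw [← hasSum_nat_add_iff' 1]
    refine (hd.mul_left (z : ℂ)).of_eq (fun n => ?_) (by simp)
    push_cast
    ring
  -- Shifting the index turns n+1-α into n+2-α; this is the source of 2-α in L.
  have hprev : HasSum (fun n : ℕ => ((n : ℂ) + 1 - α) * HardySpace.prevCoeff (maclaurin f) n
      * (z : ℂ) ^ n) (z * (z * deriv (extendDisc f) z + (2 - α) * f z)) := by
    rw [← hasSum_nat_add_iff' 1]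
    refine ((hzd.add (h0.mul_left (2 - α : ℂ))).mul_left (z : ℂ)).of_eq (fun n => ?_)
      (by simp [HardySpace.prevCoeff])
    simp only [HardySpace.prevCoeff]
    push_cast
    ring
  refine ((((hzd.add h0).mul_left (s : ℂ)).sub (h0.mul_left (α * (s - 1) : ℂ))).sub
    ((hprev.mul_left (starRingEnd ℂ a)).add (hd.mul_left a))).of_eq (fun n => ?_) ?_
  · rw [recResidual]
    ring
  · ring

/-- A power series vanishes on the disc exactly when all its coefficients do. -/
theorem recResidual_iff_deriv (α : ℝ) (a : ℂ) (s : ℝ) {f : Disc → ℂ} (hf : IsHolo f) :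
    (∀ n, recResidual α a s (maclaurin f) n = 0) ↔
      ∀ z : Disc, (starRingEnd ℂ a * (z : ℂ) ^ 2 - s * z + a) * deriv (extendDisc f) z
        = (s - α * (s - 1) - (2 - α) * starRingEnd ℂ a * z) * f z := by
  constructor
  · intro h z
    have h1 := hasSum_recResidual α a s hf z
    simp only [h, zero_mul] at h1
    exact (sub_eq_zero.mp (h1.unique hasSum_zero)).symm
  · intro h n
    have h1 : ∀ z : Disc, HasSum (fun n => recResidual α a s (maclaurin f) n * (z : ℂ) ^ n)
        ((0 : Disc → ℂ) z) := fun z => by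
      have h2 := hasSum_recResidual α a s hf z
      rwa [← h z, sub_self] at h2
    have h3 := (holo_of_hasSum h1).2
    rw [← h3, (holo_of_hasSum (f := 0) (c := 0) (fun z => by simp)).2]
    rfl

/-! ### Pointwise growth in the space -/

/-- Binomial series: 1/ω(n) is the n-th Taylor coefficient of (1-t)^(α-1). At t = |z|² the sum is
the squared norm of the reproducing kernel at z. -/
theorem hasSum_pow_div_bergmanW {α t : ℝ} (h0 : 0 ≤ t) (h1 : t < 1) :
    HasSum (fun n => t ^ n / bergmanW α n) (1 / (1 - t) ^ (1 - α)) := by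
  have h := (Real.one_div_one_sub_rpow_hasFPowerSeriesOnBall_zero (1 - α)).hasSum (y := t) (by
    rw [← ENNReal.ofReal_one, Metric.eball_ofReal]
    simpa [abs_of_nonneg h0] using h1)
  rw [zero_add] at h
  refine h.of_eq (fun n => ?_) rfl
  rw [FormalMultilinearSeries.ofScalars_apply_eq, bergmanW, div_inv_eq_mul, smul_eq_mul, mul_comm,
    show 1 - α + (n : ℝ) - 1 = n - α by ring]

/-- The growth estimate given by the reproducing kernel `(1 - z w̄) ^ (α - 1)`. -/
theorem norm_sq_mul_rpow_le {α : ℝ} (hα : α < 0) (f : BergmanSpace α hα) (z : Disc) :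
    ‖f z‖ ^ 2 * (1 - ‖(z : ℂ)‖ ^ 2) ^ (1 - α) ≤ ‖f‖ ^ 2 := by
  have hz : ‖(z : ℂ)‖ < 1 := mem_ball_zero_iff.mp z.2
  have hz2 : ‖(z : ℂ)‖ ^ 2 < 1 := by nlinarith [norm_nonneg (z : ℂ)]
  have hP : 0 < (1 - ‖(z : ℂ)‖ ^ 2) ^ (1 - α) := Real.rpow_pos_of_pos (by linarith) _
  have hK := hasSum_pow_div_bergmanW (α := α) (sq_nonneg ‖(z : ℂ)‖) hz2
  rw [← le_div_iff₀ hP, ← mul_one_div]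
  have hlim := ((f.hasSum z).tendsto_sum_nat.norm).pow 2
  refine le_of_tendsto hlim (Eventually.of_forall fun N => ?_)
  have h1 : ‖∑ n ∈ Finset.range N, f.coeff n * (z : ℂ) ^ n‖
      ≤ ∑ n ∈ Finset.range N, ‖f.coeff n‖ * ‖(z : ℂ)‖ ^ n :=
    (norm_sum_le _ _).trans_eq (by simp)
  -- Cauchy–Schwarz, with the weights ω(n) and 1/ω(n) on the two factors.
  have h2 : (∑ n ∈ Finset.range N, ‖f.coeff n‖ * ‖(z : ℂ)‖ ^ n) ^ 2
      ≤ (∑ n ∈ Finset.range N, ‖f.coeff n‖ ^ 2 * (bergmanWeight α hα).w n)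
        * ∑ n ∈ Finset.range N, (‖(z : ℂ)‖ ^ 2) ^ n / bergmanW α n := by
    refine Finset.sum_sq_le_sum_mul_sum_of_sq_le_mul _
      (fun n _ => mul_nonneg (sq_nonneg _) (bergmanW_pos hα n).le)
      (fun n _ => div_nonneg (by positivity) (bergmanW_pos hα n).le) (fun n _ => le_of_eq ?_)
    change _ = ‖f.coeff n‖ ^ 2 * bergmanW α n * _
    rw [mul_assoc, mul_div_cancel₀ _ (bergmanW_pos hα n).ne']
    ring
  have h3 := sum_le_hasSum (Finset.range N)
    (fun n _ => mul_nonneg (sq_nonneg _) (bergmanW_pos hα n).le) f.hasSum_norm_sq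
  have h4 := sum_le_hasSum (Finset.range N)
    (fun n _ => div_nonneg (by positivity) (bergmanW_pos hα n).le) hK
  calc _ ≤ (∑ n ∈ Finset.range N, ‖f.coeff n‖ * ‖(z : ℂ)‖ ^ n) ^ 2 := by gcongr
    _ ≤ _ := h2
    _ ≤ _ := mul_le_mul h3 h4 (Finset.sum_nonneg fun n _ =>
      div_nonneg (by positivity) (bergmanW_pos hα n).le) (sq_nonneg _)

/-! ### No eigenvectors when s² ≤ 4|a|² -/

/-- The orbit of `0` under the flow of disc automorphisms generated by
`i (ā z² - s z + a)`. -/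
noncomputable def orbit (a : ℂ) (s : ℝ) (t : ℝ) : ℂ := a * t / (t * (s / 2) + Complex.I)

theorem orbit_denom_ne (s t : ℝ) : (t * (s / 2) + Complex.I : ℂ) ≠ 0 := fun h => by
  simpa using congrArg Complex.im h

/-- Put κ = |a|² - s²/4 ≥ 0. If κ > 0 the orbit meets the circle at t = κ^(-1/2); if κ = 0 and s ≠ 0
it approaches the circle as t → ∞. -/
theorem one_sub_norm_orbit_sq (a : ℂ) (s t : ℝ) :
    1 - ‖orbit a s t‖ ^ 2
      = (1 - (‖a‖ ^ 2 - s ^ 2 / 4) * t ^ 2) / (1 + s ^ 2 / 4 * t ^ 2) := by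
  have h : ‖(t * (s / 2) + Complex.I : ℂ)‖ ^ 2 = 1 + s ^ 2 / 4 * t ^ 2 := by
    rw [Complex.sq_norm, Complex.normSq_apply]
    simp
    ring
  have h0 : 1 + s ^ 2 / 4 * t ^ 2 ≠ 0 := by positivity
  rw [orbit, norm_div, div_pow, h, norm_mul, mul_pow, Complex.norm_real, Real.norm_eq_abs, sq_abs]
  field_simp
  ring

/-- This velocity is -i q(z)/(1 - κt²) at the orbit point z, with κ = |a|² - s²/4. The real time
change keeps the orbit rational in t, for κ > 0 and κ = 0 alike. -/
theorem hasDerivAt_orbit (a : ℂ) (s t : ℝ) :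
    HasDerivAt (orbit a s) (a * Complex.I / (t * (s / 2) + Complex.I) ^ 2) t := by
  have h0 : HasDerivAt (fun t : ℝ => (t : ℂ)) 1 t := Complex.ofRealCLM.hasDerivAt
  have h1 := (h0.const_mul a).div ((h0.mul_const ((s : ℂ) / 2)).add_const Complex.I)
    (orbit_denom_ne s t)
  refine h1.congr_deriv ?_
  congr 1
  ring

/-- Along the orbit, `|f|² (1 - |z|²) ^ (2 - α)` is constant. -/
theorem norm_sq_orbit_const {α s : ℝ} {a : ℂ} (hs : s ^ 2 ≤ 4 * ‖a‖ ^ 2) {f : Disc → ℂ}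
    (hf : IsHolo f)
    (hode : ∀ z : Disc, (starRingEnd ℂ a * (z : ℂ) ^ 2 - s * z + a) * deriv (extendDisc f) z
        = (s - α * (s - 1) - (2 - α) * starRingEnd ℂ a * z) * f z)
    {t : ℝ} (ht0 : 0 ≤ t) (ht : (‖a‖ ^ 2 - s ^ 2 / 4) * t ^ 2 < 1) :
    ‖extendDisc f (orbit a s t)‖ ^ 2 * (1 - ‖orbit a s t‖ ^ 2) ^ (2 - α)
      = ‖extendDisc f 0‖ ^ 2 := by
  have hder : ∀ x ∈ Set.Icc 0 t, HasDerivAt (fun x => ‖extendDisc f (orbit a s x)‖ ^ 2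
      * (1 - ‖orbit a s x‖ ^ 2) ^ (2 - α)) 0 x := by
    intro x hx
    have hx1 : 0 < 1 - (‖a‖ ^ 2 - s ^ 2 / 4) * x ^ 2 := by
      have : x ^ 2 ≤ t ^ 2 := by gcongr <;> linarith [hx.1, hx.2]
      nlinarith
    have hx2 : 0 < 1 + s ^ 2 / 4 * x ^ 2 := by positivity
    have hP : 0 < (1 - (‖a‖ ^ 2 - s ^ 2 / 4) * x ^ 2) / (1 + s ^ 2 / 4 * x ^ 2) :=
      div_pos hx1 hx2
    have hball : orbit a s x ∈ Metric.ball (0 : ℂ) 1 := by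
      rw [mem_ball_zero_iff]
      rw [← one_sub_norm_orbit_sq] at hP
      nlinarith [norm_nonneg (orbit a s x)]
    have hF : HasDerivAt (extendDisc f) (deriv (extendDisc f) (orbit a s x)) (orbit a s x) :=
      (hf.differentiableAt (Metric.isOpen_ball.mem_nhds hball)).hasDerivAt
    have hW := hF.comp x (hasDerivAt_orbit a s x)
    have hode' := hode ⟨_, hball⟩
    rw [← extendDisc_apply f] at hode'
    simp only at hode'
    -- Rewriting the velocity through q lets the ODE replace q F' by L F.
    have hW' : deriv (extendDisc f) (orbit a s x)
          * (a * Complex.I / (x * (s / 2) + Complex.I) ^ 2)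
        = (-Complex.I * (s - α * (s - 1) - (2 - α) * starRingEnd ℂ a * orbit a s x)
          / (1 - (‖a‖ ^ 2 - s ^ 2 / 4) * x ^ 2 : ℝ)) * extendDisc f (orbit a s x) := by
      have hne : ((1 - (‖a‖ ^ 2 - s ^ 2 / 4) * x ^ 2 : ℝ) : ℂ) ≠ 0 :=
        Complex.ofReal_ne_zero.mpr hx1.ne'
      have hd := orbit_denom_ne s x
      have hq : starRingEnd ℂ a * orbit a s x ^ 2 - s * orbit a s x + a
          = -a * (1 - (‖a‖ ^ 2 - s ^ 2 / 4) * x ^ 2 : ℝ) / (x * (s / 2) + Complex.I) ^ 2 := by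
        have ho : orbit a s x * (x * (s / 2) + Complex.I) = a * x := div_mul_cancel₀ _ hd
        rw [eq_div_iff (pow_ne_zero 2 hd)]
        have ha : ((‖a‖ : ℝ) : ℂ) ^ 2 = starRingEnd ℂ a * a := (Complex.conj_mul' a).symm
        push_cast
        rw [ha]
        have hI := Complex.I_sq
        linear_combination a * hI + (starRingEnd ℂ a * (orbit a s x * (x * (s / 2) + Complex.I)
          + a * x) - s * (x * (s / 2) + Complex.I)) * ho
      rw [div_mul_eq_mul_div, eq_div_iff hne, mul_assoc (-Complex.I), ← hode', hq]
      field_simp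
    have hN := hW.norm_sq
    have hPd : HasDerivAt (fun x => 1 - ‖orbit a s x‖ ^ 2)
        (-(2 * ‖a‖ ^ 2 * x) / (1 + s ^ 2 / 4 * x ^ 2) ^ 2) x := by
      simp only [one_sub_norm_orbit_sq]
      have h2 := hasDerivAt_pow 2 x
      have h3 := ((h2.const_mul (‖a‖ ^ 2 - s ^ 2 / 4)).const_sub 1).div
        ((h2.const_mul (s ^ 2 / 4)).const_add 1) hx2.ne'
      refine h3.congr_deriv ?_
      congr 1
      push_cast
      ring
    have hPr := hPd.rpow_const (p := 2 - α) (Or.inl (by rw [one_sub_norm_orbit_sq]; exact hP.ne'))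
    refine (hN.mul hPr).congr_deriv ?_
    have hin : inner ℝ (extendDisc f (orbit a s x)) (deriv (extendDisc f) (orbit a s x)
          * (a * Complex.I / (x * (s / 2) + Complex.I) ^ 2))
        = (2 - α) * ‖a‖ ^ 2 * x / ((1 - (‖a‖ ^ 2 - s ^ 2 / 4) * x ^ 2)
          * (1 + s ^ 2 / 4 * x ^ 2)) * ‖extendDisc f (orbit a s x)‖ ^ 2 := by
      -- Only the real part of the logarithmic derivative affects |f|; the real constant s - α(s-1),
      -- multiplied by -i, drops out.
      have hre : (-Complex.I * (s - α * (s - 1) - (2 - α) * starRingEnd ℂ a * orbit a s x)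
          / (1 - (‖a‖ ^ 2 - s ^ 2 / 4) * x ^ 2 : ℝ)).re
          = (2 - α) * ‖a‖ ^ 2 * x / ((1 - (‖a‖ ^ 2 - s ^ 2 / 4) * x ^ 2)
          * (1 + s ^ 2 / 4 * x ^ 2)) := by
        have ho : starRingEnd ℂ a * orbit a s x
            = ((‖a‖ ^ 2 * x / (1 + s ^ 2 / 4 * x ^ 2) : ℝ) : ℂ) * (x * (s / 2) - Complex.I) := by
          have ha : ((‖a‖ : ℝ) : ℂ) ^ 2 = starRingEnd ℂ a * a := (Complex.conj_mul' a).symm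
          have hd := orbit_denom_ne s x
          have hne : (1 + (s : ℂ) ^ 2 / 4 * (x : ℂ) ^ 2) ≠ 0 := by
            exact_mod_cast Complex.ofReal_ne_zero.mpr hx2.ne'
          have hI := Complex.I_sq
          rw [orbit]
          push_cast
          rw [ha, mul_div_assoc', div_mul_eq_mul_div, div_eq_div_iff hd hne]
          linear_combination (starRingEnd ℂ a * a * x : ℂ) * hI
        have hL : -Complex.I * (s - α * (s - 1) - (2 - α) * starRingEnd ℂ a * orbit a s x)
            = (((2 - α) * (‖a‖ ^ 2 * x / (1 + s ^ 2 / 4 * x ^ 2)) : ℝ) : ℂ)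
              + (((2 - α) * (‖a‖ ^ 2 * x / (1 + s ^ 2 / 4 * x ^ 2)) * (x * (s / 2))
                - (s - α * (s - 1)) : ℝ) : ℂ) * Complex.I := by
          rw [mul_assoc _ (starRingEnd ℂ a), ho]
          push_cast
          linear_combination (-(2 - α) * (‖a‖ ^ 2 * x / (1 + s ^ 2 / 4 * x ^ 2)) : ℂ)
            * Complex.I_sq
        rw [Complex.div_ofReal_re, hL, Complex.add_re, Complex.re_ofReal_mul, Complex.I_re,
          Complex.ofReal_re]
        field_simp
        ring
      rw [hW', Complex.inner, mul_assoc, ← hre, Complex.mul_conj', ← Complex.ofReal_pow,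
        Complex.re_mul_ofReal]
    change 2 * inner ℝ (extendDisc f (orbit a s x)) _ * _ + ‖extendDisc f (orbit a s x)‖ ^ 2 * _ = 0
    rw [hin, one_sub_norm_orbit_sq, Real.rpow_sub_one hP.ne']
    field_simp
    ring
  have := constant_of_has_deriv_right_zero
    (fun x hx => (hder x hx).continuousAt.continuousWithinAt)
    (fun x hx => (hder x ⟨hx.1, hx.2.le⟩).hasDerivWithinAt) t ⟨ht0, le_rfl⟩
  simpa [orbit] using this

/-- For `s² ≤ 4|a|²` there are no eigenvectors, since the orbit of `0` reaches the circle. -/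
theorem apply_zero_eq_zero_of_sq_le {α s : ℝ} (hα : α < 0) {a : ℂ} (ha : a ≠ 0)
    (hs : s ^ 2 ≤ 4 * ‖a‖ ^ 2) (f : BergmanSpace α hα)
    (hode : ∀ z : Disc, (starRingEnd ℂ a * (z : ℂ) ^ 2 - s * z + a) * deriv (extendDisc f.1) z
        = (s - α * (s - 1) - (2 - α) * starRingEnd ℂ a * z) * f z) :
    extendDisc f.1 0 = 0 := by
  by_contra hne
  have hapos : 0 < ‖a‖ := norm_pos_iff.mpr ha
  have hb : ∀ t : ℝ, 0 ≤ t → (‖a‖ ^ 2 - s ^ 2 / 4) * t ^ 2 < 1 →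
      ‖extendDisc f.1 0‖ ^ 2
        ≤ ‖f‖ ^ 2 * ((1 - (‖a‖ ^ 2 - s ^ 2 / 4) * t ^ 2) / (1 + s ^ 2 / 4 * t ^ 2)) := by
    intro t ht0 ht
    have h1 := norm_sq_orbit_const hs f.2.1 hode ht0 ht
    have hP : 0 < (1 - (‖a‖ ^ 2 - s ^ 2 / 4) * t ^ 2) / (1 + s ^ 2 / 4 * t ^ 2) :=
      div_pos (by linarith) (by positivity)
    rw [← one_sub_norm_orbit_sq] at hP ⊢
    have hball : orbit a s t ∈ Metric.ball (0 : ℂ) 1 := by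
      rw [mem_ball_zero_iff]
      nlinarith [norm_nonneg (orbit a s t)]
    have h2 := norm_sq_mul_rpow_le hα f ⟨_, hball⟩
    rw [← extendDisc_apply f.1] at h2
    rw [← h1, show 2 - α = 1 - α + 1 by ring, Real.rpow_add_one hP.ne', ← mul_assoc]
    exact mul_le_mul_of_nonneg_right h2 hP.le
  have hc : 0 < ‖extendDisc f.1 0‖ ^ 2 := by positivity
  have hle : ‖extendDisc f.1 0‖ ^ 2 ≤ ‖f‖ ^ 2 := by
    simpa using hb 0 le_rfl (by simp)
  have hn : 0 < ‖f‖ ^ 2 := hc.trans_le hle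
  -- With κ = |a|² - s²/4 and τ = t², the bound reads δ(1 + s²τ/4) ≤ 1 - κτ whenever κτ < 1.
  obtain ⟨δ, hδ⟩ : ∃ δ, δ = ‖extendDisc f.1 0‖ ^ 2 / ‖f‖ ^ 2 := ⟨_, rfl⟩
  have hδ0 : 0 < δ := hδ ▸ div_pos hc hn
  have hδ1 : δ ≤ 1 := hδ ▸ (div_le_one hn).mpr hle
  have hb' : ∀ τ : ℝ, 0 ≤ τ → (‖a‖ ^ 2 - s ^ 2 / 4) * τ < 1 →
      δ * (1 + s ^ 2 / 4 * τ) ≤ 1 - (‖a‖ ^ 2 - s ^ 2 / 4) * τ := by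
    intro τ h0 h1
    have h2 := hb (√τ) (Real.sqrt_nonneg _) (by rwa [Real.sq_sqrt h0])
    rw [Real.sq_sqrt h0, mul_comm, ← div_le_iff₀ hn, ← hδ, le_div_iff₀ (by positivity)] at h2
    exact h2
  have hκ : 0 ≤ ‖a‖ ^ 2 - s ^ 2 / 4 := by linarith
  have hden : 0 < ‖a‖ ^ 2 - s ^ 2 / 4 + δ * (s ^ 2 / 4) / 2 := by
    have h1 : 0 < ‖a‖ ^ 2 := by positivity
    rcases hκ.eq_or_lt with h | h
    · have : 0 < s ^ 2 / 4 := by linarith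
      positivity
    · positivity
  -- This τ makes 1 - κτ equal to exactly half of δ(1 + s²τ/4): it is admissible and contradicts the
  -- bound. One choice covers both κ > 0 and κ = 0.
  obtain ⟨τ, hτ⟩ : ∃ τ, τ = (1 - δ / 2) / (‖a‖ ^ 2 - s ^ 2 / 4 + δ * (s ^ 2 / 4) / 2) := ⟨_, rfl⟩
  have hτ0 : 0 ≤ τ := hτ ▸ div_nonneg (by linarith) hden.le
  have hτ1 : (‖a‖ ^ 2 - s ^ 2 / 4 + δ * (s ^ 2 / 4) / 2) * τ = 1 - δ / 2 := by
    rw [hτ, mul_div_cancel₀ _ hden.ne']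
  have hpos : 0 ≤ δ * (s ^ 2 / 4) * τ := by positivity
  have := hb' τ hτ0 (by nlinarith)
  nlinarith

/-! ### Quantization at the zero of q inside the disc -/

/-- At a simple zero `w` of `q`, the order `j` of a nonzero analytic solution of `q F' = L F`
satisfies `q'(w) j = L(w)`. -/
theorem exists_nat_of_analytic_solution {F r L : ℂ → ℂ} {w : ℂ} (hF : AnalyticAt ℂ F w)
    (hne : ¬ ∀ᶠ z in 𝓝 w, F z = 0) (hr : ContinuousAt r w) (hL : ContinuousAt L w)
    (hode : ∀ᶠ z in 𝓝 w, (z - w) * r z * deriv F z = L z * F z) :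
    ∃ j : ℕ, r w * j = L w := by
  obtain ⟨j, g, hg, hg0, hFg⟩ := hF.exists_eventuallyEq_pow_smul_nonzero_iff.mpr hne
  refine ⟨j, ?_⟩
  -- Substitute F = (z-w)^j g with g(w) ≠ 0, cancel (z-w)^j away from w, and let z → w.
  have hlim : Tendsto (fun z => r z * (j * g z + (z - w) * deriv g z) - L z * g z) (𝓝[≠] w)
      (𝓝 (r w * (j * g w + (w - w) * deriv g w) - L w * g w)) := by
    have hg' := hg.deriv.continuousAt
    have hgc := hg.continuousAt
    have : ContinuousAt (fun z => r z * (j * g z + (z - w) * deriv g z) - L z * g z) w := by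
      fun_prop
    exact this.tendsto.mono_left nhdsWithin_le_nhds
  have hzero : ∀ᶠ z in 𝓝[≠] w, r z * (j * g z + (z - w) * deriv g z) - L z * g z = 0 := by
    filter_upwards [self_mem_nhdsWithin, nhdsWithin_le_nhds hode,
      nhdsWithin_le_nhds hFg.eventually_nhds, nhdsWithin_le_nhds hg.eventually_analyticAt]
      with z hz h1 h2 h3
    have hzw : z - w ≠ 0 := sub_ne_zero.mpr hz
    have hd : deriv F z = j * (z - w) ^ (j - 1) * g z + (z - w) ^ j * deriv g z := by
      have hE : F =ᶠ[𝓝 z] fun z => (z - w) ^ j * g z := h2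
      rw [hE.deriv_eq]
      have h4 := (((hasDerivAt_id z).sub_const w).pow j).mul h3.differentiableAt.hasDerivAt
      refine (h4.deriv.trans ?_)
      simp
    rw [hd, h2.self_of_nhds, smul_eq_mul] at h1
    -- The truncated exponent j - 1 is harmless at j = 0, where the factor j vanishes.
    have hj : (j : ℂ) * (z - w) ^ j = j * ((z - w) ^ (j - 1) * (z - w)) := by
      rcases j with _ | j
      · simp
      · simp [pow_succ]
    apply mul_left_cancel₀ (pow_ne_zero j hzw)
    linear_combination h1 + r z * g z * hj
  have h := tendsto_nhds_unique (hlim.congr' hzero) tendsto_const_nhds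
  apply mul_right_cancel₀ hg0
  linear_combination h

/-- The smaller root of `p (s - p) = b²`. -/
theorem exists_small_root {b s : ℝ} (hb : 0 < b) (hs : 4 * b ^ 2 < s ^ 2) :
    ∃ p : ℝ, p * (s - p) = b ^ 2 ∧ p ^ 2 < b ^ 2 := by
  have hr := Real.sq_sqrt (sub_nonneg.mpr hs.le)
  have hr0 : 0 < √(s ^ 2 - 4 * b ^ 2) := Real.sqrt_pos.mpr (sub_pos.mpr hs)
  generalize √(s ^ 2 - 4 * b ^ 2) = r at hr hr0
  rcases lt_or_ge 0 s with h | h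
  · have : r < s := by nlinarith
    exact ⟨(s - r) / 2, by nlinarith, by nlinarith⟩
  · have : r < -s := by nlinarith
    exact ⟨(s + r) / 2, by nlinarith, by nlinarith⟩

/-- The last hypothesis is a quadratic in p, and positivity of p selects the root (ρ_j +
α)/(2(j+1)). Eliminating |a|² between the two relations and dividing by p makes s affine in p. -/
theorem lam_of_root {α s p : ℝ} {a : ℂ} {j : ℕ} (hα : α < 0) (hsp : p * (s - p) = ‖a‖ ^ 2)
    (hp0 : 0 < p)
    (hq : ((j : ℝ) + 1) * p ^ 2 - α * p = ((j : ℝ) + 1 - α) * ‖a‖ ^ 2) :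
    rho α a j = 2 * (j + 1) * p - α ∧ lam α a j = ‖a‖ ^ 2 + 1 - s := by
  have hj : (0 : ℝ) ≤ j := j.cast_nonneg
  have h1 : 0 < (j : ℝ) + 1 - α := by linarith
  have hrho : rho α a j = 2 * (j + 1) * p - α := by
    have : 0 ≤ 2 * ((j : ℝ) + 1) * p - α := by
      have : 0 ≤ 2 * ((j : ℝ) + 1) * p := by positivity
      linarith
    rw [rho, Real.sqrt_eq_iff_eq_sq _ this]
    · linear_combination -4 * ((j : ℝ) + 1) * hq
    · have : 0 ≤ 4 * ‖a‖ ^ 2 * ((j : ℝ) + 1) * ((j : ℝ) + 1 - α) := by positivity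
      nlinarith
  refine ⟨hrho, ?_⟩
  have hs : s * ((j : ℝ) + 1 - α) = (2 * j + 2 - α) * p - α := by
    apply mul_left_cancel₀ hp0.ne'
    linear_combination ((j : ℝ) + 1 - α) * hsp - hq
  have hfrac : (α ^ 2 - (2 * (j : ℝ) + 2 - α) * (2 * (j + 1) * p - α))
      / (2 * ((j : ℝ) + 1) * ((j : ℝ) + 1 - α)) = -s := by
    rw [div_eq_iff (by positivity)]
    linear_combination 2 * ((j : ℝ) + 1) * hs
  rw [lam, hrho, hfrac, ← sub_eq_add_neg]

/-- Since p² < b², the terms with factor j+1 force -αb² < -αp, so b² < p because α < 0; with p < b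
this gives b² < b. -/
theorem pos_and_lt_one_of_root {α p b : ℝ} {j : ℕ} (hα : α < 0) (hb : 0 < b)
    (hpb : p ^ 2 < b ^ 2)
    (hq : ((j : ℝ) + 1) * p ^ 2 - α * p = ((j : ℝ) + 1 - α) * b ^ 2) : 0 < p ∧ b < 1 := by
  have hj : (0 : ℝ) < (j : ℝ) + 1 := by positivity
  have h1 : ((j : ℝ) + 1) * p ^ 2 < ((j : ℝ) + 1) * b ^ 2 := by gcongr
  have h2 : -α * b ^ 2 < -α * p := by linarith
  have h3 : b ^ 2 < p := lt_of_mul_lt_mul_left h2 (by linarith)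
  have h4 : 0 < p := (by positivity : (0 : ℝ) < b ^ 2).trans h3
  have h5 : p < b := lt_of_pow_lt_pow_left₀ 2 hb.le hpb
  exact ⟨h4, by nlinarith⟩

/-- Intermediate values: at p = b the left side exceeds the right by -α(b - b²), which is positive
because b < 1. -/
theorem exists_root {α : ℝ} (hα : α < 0) {b : ℝ} (hb : 0 < b) (hb1 : b < 1) (j : ℕ) :
    ∃ p : ℝ, 0 < p ∧ p < b ∧
      ((j : ℝ) + 1) * p ^ 2 - α * p = ((j : ℝ) + 1 - α) * b ^ 2 := by
  have hj : (0 : ℝ) < (j : ℝ) + 1 := by positivity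
  have hcont : ContinuousOn (fun p : ℝ => ((j : ℝ) + 1) * p ^ 2 - α * p) (Set.Icc 0 b) := by
    fun_prop
  have hb2 : b ^ 2 < b := by nlinarith
  have hmem : ((j : ℝ) + 1 - α) * b ^ 2
      ∈ Set.Ioo (((j : ℝ) + 1) * 0 ^ 2 - α * 0) (((j : ℝ) + 1) * b ^ 2 - α * b) := by
    have : 0 < (j : ℝ) + 1 - α := by linarith
    constructor
    · have := mul_pos this (pow_pos hb 2)
      simpa using this
    · nlinarith
  obtain ⟨p, hp, hpe⟩ := intermediate_value_Ioo hb.le hcont hmem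
  exact ⟨p, hp.1, hp.2, hpe⟩

/-- Here q = (z - w)(āz + p - s) with w = p/ā in the disc. The order of f at w is finite by the
identity theorem, and it determines s. Only holomorphy of f is needed, not finite norm. -/
theorem holo_eigen_exists_nat {α s : ℝ} (hα : α < 0) {a : ℂ} (ha : a ≠ 0)
    (hs : 4 * ‖a‖ ^ 2 < s ^ 2) {f : Disc → ℂ} (hf : IsHolo f) (hne : f ≠ 0)
    (hode : ∀ z : Disc, (starRingEnd ℂ a * (z : ℂ) ^ 2 - s * z + a) * deriv (extendDisc f) z
        = (s - α * (s - 1) - (2 - α) * starRingEnd ℂ a * z) * f z) :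
    ‖a‖ < 1 ∧ ∃ j : ℕ, lam α a j = ‖a‖ ^ 2 + 1 - s := by
  have hapos : 0 < ‖a‖ := norm_pos_iff.mpr ha
  have hac : starRingEnd ℂ a ≠ 0 := (map_ne_zero _).mpr ha
  obtain ⟨p, hp1, hp2⟩ := exists_small_root hapos hs
  obtain ⟨w, hw⟩ : ∃ w : ℂ, w = p / starRingEnd ℂ a := ⟨_, rfl⟩
  have hwp : starRingEnd ℂ a * w = p := by
    rw [hw, mul_div_cancel₀ _ hac]
  have hball : w ∈ Metric.ball (0 : ℂ) 1 := by
    rw [mem_ball_zero_iff, hw, norm_div, Complex.norm_real, RCLike.norm_conj, div_lt_one hapos]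
    exact sq_lt_sq₀ (norm_nonneg _) hapos.le |>.mp (by simpa using hp2)
  have hpc : (p : ℂ) * (s - p) = starRingEnd ℂ a * a := by
    rw [Complex.conj_mul']
    exact_mod_cast congrArg Complex.ofReal hp1
  have han : AnalyticOnNhd ℂ (extendDisc f) (Metric.ball 0 1) := hf.analyticOnNhd Metric.isOpen_ball
  obtain ⟨j, hj⟩ := exists_nat_of_analytic_solution (F := extendDisc f)
    (r := fun z => starRingEnd ℂ a * z + p - s)
    (L := fun z => s - α * (s - 1) - (2 - α) * starRingEnd ℂ a * z) (han w hball)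
    (fun h => hne (funext fun z => by
      rw [← extendDisc_apply f]
      exact han.eqOn_zero_of_preconnected_of_eventuallyEq_zero
        (convex_ball 0 1).isPreconnected hball h z.2))
    (by fun_prop) (by fun_prop) (by
      filter_upwards [Metric.isOpen_ball.mem_nhds hball] with z hz
      have h := hode ⟨z, hz⟩
      rw [← extendDisc_apply f] at h
      simp only at h
      rw [← h]
      congr 1
      apply mul_left_cancel₀ hac
      linear_combination (-starRingEnd ℂ a * z - p + s) * hwp + hpc)
  rw [mul_assoc _ (starRingEnd ℂ a), hwp] at hj
  have hj' : (p + p - s) * j = s - α * (s - 1) - (2 - α) * p := by exact_mod_cast hj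
  -- Multiply the order relation by p and replace p(s - p) by |a|² to eliminate s.
  have hq : ((j : ℝ) + 1) * p ^ 2 - α * p = ((j : ℝ) + 1 - α) * ‖a‖ ^ 2 := by
    linear_combination p * hj' + ((j : ℝ) + 1 - α) * hp1
  obtain ⟨hp0, hlt⟩ := pos_and_lt_one_of_root hα hapos hp2 hq
  exact ⟨hlt, j, (lam_of_root hα hp1 hp0 hq).2⟩

/-! ### Construction of the eigenvectors -/

/-- A function holomorphic on a disc of radius greater than one belongs to the space. -/
theorem exists_bergman_of_differentiableOn {α : ℝ} (hα : α < 0) {H : ℂ → ℂ} {R : ℝ} (hR : 1 < R)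
    (hH : DifferentiableOn ℂ H (Metric.ball 0 R)) :
    ∃ h : BergmanSpace α hα, ∀ z : Disc, h z = H z := by
  have hsum : ∀ z ∈ Metric.ball (0 : ℂ) R,
      HasSum (fun n : ℕ => iteratedDeriv n H 0 / (n.factorial : ℂ) * z ^ n) (H z) := fun z hz =>
    (Complex.hasSum_taylorSeries_on_ball hH hz).of_eq
      (fun n => by simp only [smul_eq_mul, sub_zero]; ring) rfl
  -- Convergence at z = 1 gives absolutely summable coefficients; they are eventually below 1, so
  -- their squares are smaller still, and the weights are at most 1.
  have h1 := (hsum 1 (by simpa using hR)).summable.norm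
  simp only [one_pow, mul_one] at h1
  have hw : ∀ n, bergmanW α n ≤ 1 := fun n => by
    have hanti : Antitone (bergmanW α) := antitone_nat_of_succ_le fun n => by
      have h0 : 0 < (n : ℝ) + 1 - α := by linarith [(n.cast_nonneg : (0 : ℝ) ≤ n)]
      rw [← div_le_one (bergmanW_pos hα n), bergmanW_ratio hα]
      linarith [div_neg_of_neg_of_pos hα h0]
    simpa [bergmanW] using hanti n.zero_le
  obtain ⟨h, hh⟩ := HardySpace.exists_of_summable (ω := bergmanWeight α hα)
    (fun n => iteratedDeriv n H 0 / (n.factorial : ℂ)) (by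
      refine Summable.of_norm_bounded_eventually_nat h1 ?_
      filter_upwards [h1.tendsto_atTop_zero.eventually (gt_mem_nhds one_pos)] with n hn
      have hw0 := bergmanW_pos hα n
      change ‖_ * bergmanW α n‖ ≤ _
      rw [Real.norm_of_nonneg (by positivity)]
      have h0 := norm_nonneg (iteratedDeriv n H 0 / (n.factorial : ℂ))
      calc _ ≤ ‖iteratedDeriv n H 0 / (n.factorial : ℂ)‖ ^ 2 * 1 := by gcongr; exact hw n
        _ ≤ _ := by nlinarith)
  refine ⟨h, fun z => ?_⟩
  have h2 := h.hasSum z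
  rw [hh] at h2
  exact h2.unique (hsum z (Metric.ball_subset_ball hR.le z.2))

theorem hasDerivAt_eigenfunction {c d m z : ℂ} {j : ℕ} (hz : 1 - d * z ∈ Complex.slitPlane) :
    HasDerivAt (fun z => (z - c) ^ j / (1 - d * z) ^ m)
      ((j * (z - c) ^ (j - 1) + (z - c) ^ j * (m * d / (1 - d * z))) / (1 - d * z) ^ m) z := by
  have hne : 1 - d * z ≠ 0 := Complex.slitPlane_ne_zero hz
  have h1 := ((hasDerivAt_id z).sub_const c).pow j
  have h2 := ((((hasDerivAt_id z).const_mul d).const_sub 1).cpow_const (c := m) hz)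
  have hp : (1 - d * z) ^ m ≠ 0 := by simp [Complex.cpow_eq_zero_iff, hne]
  refine (h1.div h2 hp).congr_deriv ?_
  simp only [id, Complex.cpow_sub _ _ hne, Complex.cpow_one, Pi.pow_apply]
  field_simp
  ring

/-- The zeros of q are p/ā and a/p, and partial fractions of L/q give the exponents j and -(j+2-α).
Since p < |a|, the singularity a/p lies outside the closed disc. -/
theorem exists_eigenvector {α : ℝ} (hα : α < 0) {a : ℂ} {s p : ℝ} {j : ℕ} (ha : a ≠ 0)
    (hp0 : 0 < p) (hpa : p < ‖a‖) (hsp : p * (s - p) = ‖a‖ ^ 2)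
    (hq : ((j : ℝ) + 1) * p ^ 2 - α * p = ((j : ℝ) + 1 - α) * ‖a‖ ^ 2) :
    ∃ h : BergmanSpace α hα, (∀ z : Disc, h z =
        ((z : ℂ) - p / starRingEnd ℂ a) ^ j / (1 - p / a * z) ^ ((j : ℂ) + 2 - α)) ∧ h ≠ 0 ∧
      HardySpace.V (bergmanWeight α hα) a h = ((‖a‖ ^ 2 + 1 - s : ℝ) : ℂ) • h := by
  have hac : starRingEnd ℂ a ≠ 0 := (map_ne_zero _).mpr ha
  have hpc0 : (p : ℂ) ≠ 0 := Complex.ofReal_ne_zero.mpr hp0.ne'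
  have hapos : 0 < ‖a‖ := norm_pos_iff.mpr ha
  have hslit : ∀ z ∈ Metric.ball (0 : ℂ) (‖a‖ / p), 1 - p / a * z ∈ Complex.slitPlane := by
    intro z hz
    rw [sub_eq_add_neg]
    apply Complex.mem_slitPlane_of_norm_lt_one
    rw [norm_neg, norm_mul, norm_div, Complex.norm_real, Real.norm_of_nonneg hp0.le]
    rw [mem_ball_zero_iff, lt_div_iff₀ hp0] at hz
    rw [div_mul_eq_mul_div, div_lt_one hapos]
    linarith
  have hR : 1 < ‖a‖ / p := (one_lt_div hp0).mpr hpa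
  obtain ⟨h, hh⟩ := exists_bergman_of_differentiableOn hα hR
    (H := fun z => (z - p / starRingEnd ℂ a) ^ j / (1 - p / a * z) ^ ((j : ℂ) + 2 - α))
    fun z hz => (hasDerivAt_eigenfunction (hslit z hz)).differentiableAt.differentiableWithinAt
  refine ⟨h, hh, fun h0 => ?_, ?_⟩
  · have h1 := hh ⟨0, by simp⟩
    rw [h0] at h1
    change (0 : ℂ) = _ at h1
    have h2 : (-(p / starRingEnd ℂ a)) ^ j = 0 := by simpa using h1.symm
    exact pow_ne_zero j (neg_ne_zero.mpr (div_ne_zero hpc0 hac)) h2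
  · rw [V_eigen_iff_recResidual]
    refine (recResidual_iff_deriv α a s h.2.1).mpr fun z => ?_
    have hz' : (z : ℂ) ∈ Metric.ball (0 : ℂ) (‖a‖ / p) := Metric.ball_subset_ball hR.le z.2
    have hE : extendDisc h.1 =ᶠ[𝓝 (z : ℂ)]
        fun z => (z - p / starRingEnd ℂ a) ^ j / (1 - p / a * z) ^ ((j : ℂ) + 2 - α) := by
      filter_upwards [Metric.isOpen_ball.mem_nhds z.2] with y hy
      exact (extendDisc_apply h.1 ⟨y, hy⟩).trans (hh ⟨y, hy⟩)
    have hne := Complex.slitPlane_ne_zero (hslit z hz')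
    rw [hE.deriv_eq, (hasDerivAt_eigenfunction (hslit z hz')).deriv, hh z]
    have hpc : (p : ℂ) * (s - p) = starRingEnd ℂ a * a := by
      rw [Complex.conj_mul']
      exact_mod_cast congrArg Complex.ofReal hsp
    have hqc : ((j : ℂ) + 1) * p ^ 2 - α * p = ((j : ℂ) + 1 - α) * (starRingEnd ℂ a * a) := by
      rw [Complex.conj_mul']
      exact_mod_cast congrArg Complex.ofReal hq
    have hX1 : (s - p : ℂ) * (p / a) = starRingEnd ℂ a := by
      rw [mul_div_assoc', div_eq_iff ha, mul_comm, hpc]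
    have hX2 : starRingEnd ℂ a * (p / starRingEnd ℂ a) = p := mul_div_cancel₀ _ hac
    -- Equivalent to (2p - s) j = L(p/ā): the residue of L/q at p/ā is j.
    have hq' : ((j : ℂ) + 1) * p - α = ((j : ℂ) + 1 - α) * (s - p) := by
      apply mul_left_cancel₀ hpc0
      linear_combination hqc - ((j : ℂ) + 1 - α) * hpc
    have hX3 : (s - p : ℂ) * (p / starRingEnd ℂ a) = a := by
      rw [mul_div_assoc', div_eq_iff hac, mul_comm, hpc, mul_comm]
    have hfac : starRingEnd ℂ a * (z : ℂ) ^ 2 - s * z + a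
        = -(s - p) * ((z : ℂ) - p / starRingEnd ℂ a) * (1 - p / a * z) := by
      linear_combination (-(z : ℂ) ^ 2 + (z : ℂ) * (p / starRingEnd ℂ a)) * hX1 - hX3
        + (z : ℂ) * hX2
    have hj : (j : ℂ) * ((z : ℂ) - p / starRingEnd ℂ a) ^ j
        = j * (((z : ℂ) - p / starRingEnd ℂ a) ^ (j - 1) * ((z : ℂ) - p / starRingEnd ℂ a)) := by
      rcases j with _ | j
      · simp
      · simp [pow_succ]
    have hcoef : -(s - p) * (j * (1 - p / a * z)
          + ((j : ℂ) + 2 - α) * (p / a) * ((z : ℂ) - p / starRingEnd ℂ a))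
        = s - α * (s - 1) - (2 - α) * starRingEnd ℂ a * z := by
      linear_combination ((j : ℂ) * z - ((j : ℂ) + 2 - α) * (z - p / starRingEnd ℂ a)) * hX1
        + ((j : ℂ) + 2 - α) * hX2 + hq'
    rw [hfac, ← hcoef]
    have hD : (1 - p / a * (z : ℂ)) * (((j : ℂ) + 2 - α) * (p / a) / (1 - p / a * (z : ℂ)))
        = ((j : ℂ) + 2 - α) * (p / a) := mul_div_cancel₀ _ hne
    linear_combination ((1 - p / a * (z : ℂ)) ^ ((j : ℂ) + 2 - α))⁻¹ * (s - p)
      * ((1 - p / a * (z : ℂ)) * hj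
        - ((z : ℂ) - p / starRingEnd ℂ a) * ((z : ℂ) - p / starRingEnd ℂ a) ^ j * hD)

/-! ### Multiplicity one and conclusion -/

theorem coeff_eq_zero_of_recResidual {α : ℝ} (hα : α < 0) {a : ℂ} {s : ℝ} (ha : a ≠ 0)
    {f : BergmanSpace α hα} (hf : ∀ n, recResidual α a s f.coeff n = 0) (h0 : f.coeff 0 = 0) :
    f = 0 := by
  have hc : ∀ n, HardySpace.prevCoeff f.coeff n = 0 ∧ f.coeff n = 0 := by
    intro n
    induction n with
    | zero => exact ⟨rfl, h0⟩
    | succ n ih =>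
      refine ⟨ih.2, ?_⟩
      have h := hf n
      rw [recResidual, ih.1, ih.2] at h
      simpa [ha, Nat.cast_add_one_ne_zero n] using h
  have hz : (0 : BergmanSpace α hα).coeff = 0 := by
    simpa using HardySpace.coeff_smul (0 : ℂ) (0 : BergmanSpace α hα)
  exact HardySpace.eq_of_coeff_eq (hz ▸ funext fun n => (hc n).2)

/-- Eigenvalues of `V_a` exist only for `|a| < 1`, and they are of the form `lam α a j`. -/
theorem norm_lt_one_of_eigen {α : ℝ} (hα : α < 0) {a μ : ℂ} (ha : a ≠ 0) {f : BergmanSpace α hα}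
    (hf : f ≠ 0) (h : HardySpace.V (bergmanWeight α hα) a f = μ • f) :
    ‖a‖ < 1 ∧ ∃ j : ℕ, ((lam α a j : ℝ) : ℂ) = μ := by
  obtain ⟨r, rfl⟩ := HardySpace.exists_real_of_eigen hf h
  obtain ⟨s, rfl⟩ : ∃ s, r = ‖a‖ ^ 2 + 1 - s := ⟨‖a‖ ^ 2 + 1 - r, by ring⟩
  have hrec := (V_eigen_iff_recResidual hα a s f).mp h
  have hode := (recResidual_iff_deriv α a s f.2.1).mp hrec
  rcases le_or_gt (s ^ 2) (4 * ‖a‖ ^ 2) with hs | hs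
  · have h0 : f.coeff 0 = 0 := by
      have := apply_zero_eq_zero_of_sq_le hα ha hs f hode
      simpa [HardySpace.coeff, maclaurin] using this
    exact absurd (coeff_eq_zero_of_recResidual hα ha hrec h0) hf
  · obtain ⟨h1, j, hj⟩ := holo_eigen_exists_nat hα ha hs f.2.1 (fun h0 => hf (Subtype.ext h0)) hode
    exact ⟨h1, j, by rw [hj]⟩

/-- The constant term of h cannot vanish, so by `recResidual_unique` every eigenvector f is
(f(0)/h(0)) h. -/
theorem ker_eq_span {α : ℝ} (hα : α < 0) {a : ℂ} {s : ℝ} (ha : a ≠ 0) {h : BergmanSpace α hα}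
    (h0 : h ≠ 0) (hV : HardySpace.V (bergmanWeight α hα) a h = ((‖a‖ ^ 2 + 1 - s : ℝ) : ℂ) • h) :
    LinearMap.ker (HardySpace.V (bergmanWeight α hα) a - ((‖a‖ ^ 2 + 1 - s : ℝ) : ℂ)
      • ContinuousLinearMap.id ℂ (BergmanSpace α hα)).toLinearMap = Submodule.span ℂ {h} := by
  have hrec := (V_eigen_iff_recResidual hα a s h).mp hV
  have hc0 : h.coeff 0 ≠ 0 := fun hz => h0 (coeff_eq_zero_of_recResidual hα ha hrec hz)
  ext f
  rw [LinearMap.mem_ker, Submodule.mem_span_singleton]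
  have hiff : (HardySpace.V (bergmanWeight α hα) a - ((‖a‖ ^ 2 + 1 - s : ℝ) : ℂ)
      • ContinuousLinearMap.id ℂ (BergmanSpace α hα)).toLinearMap f = 0
      ↔ HardySpace.V (bergmanWeight α hα) a f = ((‖a‖ ^ 2 + 1 - s : ℝ) : ℂ) • f := by
    rw [← sub_eq_zero (a := HardySpace.V (bergmanWeight α hα) a f)]
    rfl
  rw [hiff]
  constructor
  · intro hf
    have hfrec := (V_eigen_iff_recResidual hα a s f).mp hf
    refine ⟨f.coeff 0 / h.coeff 0, HardySpace.eq_of_coeff_eq (funext fun n => ?_)⟩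
    rw [HardySpace.coeff_smul, Pi.smul_apply, smul_eq_mul, div_mul_eq_mul_div, div_eq_iff hc0,
      ← recResidual_unique ha hfrec hrec n, mul_comm]
  · rintro ⟨k, rfl⟩
    rw [map_smul, hV, smul_comm]

theorem theorem5p1 (α : ℝ) (hα : α < 0) (a : ℂ) :
    (0 < ‖a‖ → ‖a‖ < 1 →
      pointSpectrum (HardySpace.V (bergmanWeight α hα) a)
          = Set.range (fun j : ℕ => ((lam α a j : ℝ) : ℂ)) ∧
      ∀ j : ℕ,
        Module.finrank ℂ
          (LinearMap.ker (HardySpace.V (bergmanWeight α hα) a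
            - ((lam α a j : ℝ) : ℂ) • ContinuousLinearMap.id ℂ (BergmanSpace α hα)).toLinearMap) = 1 ∧
        ∃ h : BergmanSpace α hα,
          (∀ z : Disc, h z =
            ((z : ℂ) - ((rho α a j + α : ℝ) : ℂ) / (2 * starRingEnd ℂ a * ((j : ℂ) + 1))) ^ j
            / (1 - ((rho α a j + α : ℝ) : ℂ) / (2 * a * ((j : ℂ) + 1)) * (z : ℂ))
                ^ ((j : ℂ) + 2 - (α : ℂ))) ∧
          LinearMap.ker (HardySpace.V (bergmanWeight α hα) a
            - ((lam α a j : ℝ) : ℂ) • ContinuousLinearMap.id ℂ (BergmanSpace α hα)).toLinearMap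
            = Submodule.span ℂ {h}) ∧
    (1 ≤ ‖a‖ → pointSpectrum (HardySpace.V (bergmanWeight α hα) a) = ∅) := by
  refine ⟨fun ha0 ha1 => ?_, fun ha1 => ?_⟩
  · have ha : a ≠ 0 := norm_pos_iff.mp ha0
    have hex : ∀ j : ℕ, ∃ h : BergmanSpace α hα, (∀ z : Disc, h z =
            ((z : ℂ) - ((rho α a j + α : ℝ) : ℂ) / (2 * starRingEnd ℂ a * ((j : ℂ) + 1))) ^ j
            / (1 - ((rho α a j + α : ℝ) : ℂ) / (2 * a * ((j : ℂ) + 1)) * (z : ℂ))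
                ^ ((j : ℂ) + 2 - (α : ℂ))) ∧ h ≠ 0 ∧
          HardySpace.V (bergmanWeight α hα) a h = ((lam α a j : ℝ) : ℂ) • h ∧
          LinearMap.ker (HardySpace.V (bergmanWeight α hα) a - ((lam α a j : ℝ) : ℂ)
            • ContinuousLinearMap.id ℂ (BergmanSpace α hα)).toLinearMap = Submodule.span ℂ {h} := by
      intro j
      obtain ⟨p, hp0, hpa, hq⟩ := exists_root hα ha0 ha1 j
      -- The value of s for which p/ā is a zero of q, that is p(s - p) = |a|².
      obtain ⟨s, hs⟩ : ∃ s, s = p + ‖a‖ ^ 2 / p := ⟨_, rfl⟩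
      have hsp : p * (s - p) = ‖a‖ ^ 2 := by
        rw [hs, add_sub_cancel_left, mul_div_cancel₀ _ hp0.ne']
      obtain ⟨hrho, hlam⟩ := lam_of_root hα hsp hp0 hq
      obtain ⟨h, hh, hne, hV⟩ := exists_eigenvector hα ha hp0 hpa hsp hq
      refine ⟨h, fun z => ?_, hne, hlam ▸ hV, hlam ▸ ker_eq_span hα ha hne hV⟩
      have hj : (j : ℂ) + 1 ≠ 0 := Nat.cast_add_one_ne_zero j
      have hdiv : ∀ b : ℂ, ((rho α a j + α : ℝ) : ℂ) / (2 * b * ((j : ℂ) + 1)) = p / b := by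
        intro b
        rw [hrho, sub_add_cancel]
        push_cast
        rw [mul_right_comm 2 b, mul_div_mul_left _ _ (mul_ne_zero two_ne_zero hj)]
      rw [hh z, hdiv, hdiv]
    refine ⟨Set.ext fun μ => ⟨?_, ?_⟩, fun j => ?_⟩
    · rintro ⟨f, hf, hV⟩
      exact (norm_lt_one_of_eigen hα ha hf hV).2
    · rintro ⟨j, rfl⟩
      obtain ⟨h, -, hne, hV, -⟩ := hex j
      exact ⟨h, hne, hV⟩
    · obtain ⟨h, hh, hne, -, hker⟩ := hex j
      exact ⟨by rw [hker]; exact finrank_span_singleton hne, h, hh, hker⟩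
  · have ha : a ≠ 0 := norm_pos_iff.mp (one_pos.trans_le ha1)
    refine Set.eq_empty_iff_forall_notMem.mpr ?_
    rintro μ ⟨f, hf, hV⟩
    exact absurd (norm_lt_one_of_eigen hα ha hf hV).1 ha1.not_gt
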